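/- Let $K$ base stations have fixed positions in the plane $\mathbb{R}^2$, the $k$-th with polar coordinates $(r_{b,k},\theta_{b,k})$. Let the eavesdroppers $e_1,e_2,\dots$ be the points of a stationary Poisson point process $\Phi_e$ on $\mathbb{R}^2$ with density $\lambda_e>0$, let $r_{j,k}$ be the distance from $e_j$ to the $k$-th base station, and let the fading coefficients $h_{j,k}$ be i.i.d. circularly symmetric complex Gaussian with zero mean and unit variance, independent of $\Phi_e$. Let $\rho>0$, let $\alpha>0$ be the path-loss exponent, and put $$I_e=\sum_{e_j\in\Phi_e}\rho\,\Big|\sum_{k=1}^K h_{j,k}\,r_{j,k}^{-\alpha/2}\Big|^2\in[0,\infty].$$ Then for every real $s\ge 0$ the Laplace transform $\mathcal{L}_{I_e}(s)=\mathbb{E}[e^{-sI_e}]$ is $$\mathcal{L}_{I_e}(s)=\exp\left(-\lambda_e\int_0^{\infty}\int_0^{2\pi}\frac{s\rho\sum_{k=1}^K r_k^{-\alpha}}{1+s\rho\sum_{k=1}^K r_k^{-\alpha}}\,r\,d\theta\,dr\right),\qquad r_k=\sqrt{r_{b,k}^2+r^2-2r_{b,k}r\cos(\theta_{b,k}-\theta)},$$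 where $e^{-\infty}=0$ and $0\cdot\infty=0$. If $\alpha>2$, then $I_e<\infty$ almost surely and the integral is finite. If the family of base stations is symmetric under the reflection $(r,\theta)\mapsto(r,-\theta)$ in the polar axis (for instance if all of them lie on the axis), then also $$\mathcal{L}_{I_e}(s)=\exp\left(-2\lambda_e\int_0^{\infty}\int_0^{\pi}\frac{s\rho\sum_{k=1}^K r_k^{-\alpha}}{1+s\rho\sum_{k=1}^K r_k^{-\alpha}}\,r\,d\theta\,dr\right).$$ -/

import Mathlib

open MeasureTheory ProbabilityTheory Set
open scoped ENNReal NNReal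

noncomputable section

namespace JointTransmission

/-- The Euclidean plane. -/
abbrev Plane : Type := EuclideanSpace ℝ (Fin 2)

/-- The point of the plane with polar coordinates `(r, θ)`. -/
def polarPoint (r θ : ℝ) : Plane := !₂[r * Real.cos θ, r * Real.sin θ]

/-- The law `CN(0, 1)` of a circularly symmetric complex Gaussian variable with zero mean and unit
variance: the real and imaginary parts are independent, each `N(0, 1/2)`. -/
def complexGaussian : Measure ℂ :=
  ((gaussianReal 0 (1 / 2)).prod (gaussianReal 0 (1 / 2))).map (fun p : ℝ × ℝ => (⟨p.1, p.2⟩ : ℂ))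

variable {Ω : Type*}

/-- The number of points of the configuration `e 0 ω, e 1 ω, …` that lie in `A`. -/
def pointCount (e : ℕ → Ω → Plane) (A : Set Plane) (ω : Ω) : ℝ≥0∞ :=
  ∑' j, A.indicator (fun _ => (1 : ℝ≥0∞)) (e j ω)

/-- `e` enumerates a stationary Poisson point process on the plane with density `lam > 0`:
the number of points in a bounded Borel set `A` is Poisson with mean `lam * |A|`, and the numbers of
points in pairwise disjoint bounded Borel sets are independent.  (As `lam > 0`, the process almost
surely has infinitely many points, so that it is enumerated by `ℕ`.) -/
structure IsPoissonPointProcess [MeasurableSpace Ω] (P : Measure Ω) (lam : ℝ)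
    (e : ℕ → Ω → Plane) : Prop where
  measurable : ∀ j, Measurable (e j)
  count_law : ∀ A : Set Plane, MeasurableSet A → Bornology.IsBounded A →
    HasLaw (pointCount e A)
      ((poissonMeasure (lam * volume.real A).toNNReal).map (fun n : ℕ => (n : ℝ≥0∞))) P
  count_indep : ∀ (n : ℕ) (A : Fin n → Set Plane), (∀ i, MeasurableSet (A i)) →
    (∀ i, Bornology.IsBounded (A i)) → Pairwise (fun i i' => Disjoint (A i) (A i')) →
    iIndepFun (fun i => pointCount e (A i)) P

/-- The random environment: the eavesdroppers `e j` form a stationary Poisson point process of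
density `lam`; the fading coefficients `h j k` (from base station `k` to eavesdropper `j`) are
i.i.d. `CN(0, 1)`, and independent of the eavesdroppers' locations. -/
structure IsRayleighPoissonModel [MeasurableSpace Ω] (P : Measure Ω) (K : ℕ) (lam : ℝ)
    (e : ℕ → Ω → Plane) (h : ℕ → Fin K → Ω → ℂ) : Prop where
  poisson : IsPoissonPointProcess P lam e
  fading_measurable : ∀ j k, Measurable (h j k)
  fading_law : ∀ j k, HasLaw (h j k) complexGaussian P
  fading_indep : iIndepFun (fun (jk : ℕ × Fin K) => h jk.1 jk.2) P
  fading_indep_points :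
    IndepFun (fun ω (jk : ℕ × Fin K) => h jk.1 jk.2 ω) (fun ω (j : ℕ) => e j ω) P

/-- The received signal-to-noise ratio of eavesdropper `j` under joint transmission,
`ρ |∑ₖ h_{j,k} r_{j,k}^{-α/2}|²`, where base station `k` has polar coordinates `(rb k, θb k)` and
`r_{j,k}` is its distance to eavesdropper `j`. -/
def snr {K : ℕ} (rb θb : Fin K → ℝ) (α ρ : ℝ) (e : ℕ → Ω → Plane) (h : ℕ → Fin K → Ω → ℂ)
    (j : ℕ) (ω : Ω) : ℝ :=
  ρ * ‖∑ k, h j k ω * ((dist (e j ω) (polarPoint (rb k) (θb k)) ^ (-α / 2) : ℝ) : ℂ)‖ ^ 2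

/-- The aggregate signal-to-noise ratio `I_e = ∑_j SNR_j`, with values in `[0, ∞]`. -/
def aggregateSNR {K : ℕ} (rb θb : Fin K → ℝ) (α ρ : ℝ) (e : ℕ → Ω → Plane)
    (h : ℕ → Fin K → Ω → ℂ) (ω : Ω) : ℝ≥0∞ :=
  ∑' j, ENNReal.ofReal (snr rb θb α ρ e h j ω)

/-- `exp (-x)` for `x ∈ [0, ∞]`, with `exp (-∞) = 0`. -/
def expNeg (x : ℝ≥0∞) : ℝ≥0∞ := EReal.exp (-(x : EReal))

/-- The Laplace transform `E[exp (-s X)]`, `s ≥ 0`, of a `[0, ∞]`-valued random variable. -/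
def laplaceTransform [MeasurableSpace Ω] (P : Measure Ω) (X : Ω → ℝ≥0∞) (s : ℝ) : ℝ≥0∞ :=
  ∫⁻ ω, expNeg (ENNReal.ofReal s * X ω) ∂P

/-- The distance between the points with polar coordinates `(r₀, θ₀)` and `(r, θ)`. -/
def polarDist (r₀ θ₀ r θ : ℝ) : ℝ :=
  Real.sqrt (r₀ ^ 2 + r ^ 2 - 2 * r₀ * r * Real.cos (θ₀ - θ))

/-- The integrand `sρ ∑ₖ rₖ^{-α} / (1 + sρ ∑ₖ rₖ^{-α})` at the point with polar coordinates
`(r, θ)`, `rₖ` being the distance of that point to base station `k`. -/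
def integrand {K : ℕ} (rb θb : Fin K → ℝ) (α ρ s r θ : ℝ) : ℝ :=
  (s * ρ * ∑ k, polarDist (rb k) (θb k) r θ ^ (-α)) /
    (1 + s * ρ * ∑ k, polarDist (rb k) (θb k) r θ ^ (-α))

/-- The family of base stations is symmetric under reflection in the polar axis
`(r, θ) ↦ (r, -θ)`; for instance, all base stations may lie on the axis. -/
def IsAxiallySymmetric {K : ℕ} (rb θb : Fin K → ℝ) : Prop :=
  ∃ σ : Equiv.Perm (Fin K), ∀ k,
    polarPoint (rb (σ k)) (θb (σ k)) = polarPoint (rb k) (-θb k)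

end JointTransmission

end

namespace JointTransmission

open Filter Topology

/-! Condition on the positions, which are independent of the fading. At a point `x` the amplitude
`∑ₖ hₖ rₖ^{-α/2}` is centred complex Gaussian with variance `∑ₖ rₖ^{-α}`, so its squared modulus is
exponential and the factor `E[exp (-s SNR)]` equals `1 / (1 + u(x))` with `u = sρ ∑ₖ rₖ^{-α}`. Given
the positions the rows of fading are independent, so the conditional transform is `∏ 1 / (1 + u(e
j)) = exp (-∑ log (1 + u(e j)))` (`lintegral_expNeg_tsum_rows`). The Laplace functional of the
Poisson process (`IsPoissonPointProcess.laplace`) at `f = log (1 + u)` gives `exp (-lam ∫ (1 - exp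
(-f)))`, and `1 - exp (-f) = u / (1 + u)`. Polar coordinates give the stated integral.

All of this takes place in `[0, ∞]`, so no convergence is needed. For `α > 2` the function `u / (1 +
u)` is bounded near the stations and decays like `|x|^{-α}`, hence is integrable on the plane;
letting `s → 0` in the transform then shows that the aggregate is almost surely finite, and the
identity passes to real numbers. -/

/-! ### The exponential `exp (-x)` on `[0, ∞]`. -/

theorem expNeg_zero : expNeg 0 = 1 := by simp [expNeg]

theorem expNeg_top : expNeg ⊤ = 0 := by simp [expNeg]

theorem expNeg_ofReal {x : ℝ} (hx : 0 ≤ x) :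
    expNeg (ENNReal.ofReal x) = ENNReal.ofReal (Real.exp (-x)) := by
  rw [expNeg, EReal.coe_ennreal_ofReal, max_eq_left hx, ← EReal.coe_neg, EReal.exp_coe]

theorem expNeg_add (x y : ℝ≥0∞) : expNeg (x + y) = expNeg x * expNeg y := by
  rw [expNeg, expNeg, expNeg, ← EReal.exp_add, EReal.coe_ennreal_add, EReal.neg_add,
    sub_eq_add_neg] <;> simp

theorem antitone_expNeg : Antitone expNeg := fun x y hxy => by
  unfold expNeg
  exact EReal.exp_monotone (EReal.neg_le_neg_iff.2 (EReal.coe_ennreal_le_coe_ennreal_iff.2 hxy))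

theorem expNeg_le_one (x : ℝ≥0∞) : expNeg x ≤ 1 :=
  expNeg_zero ▸ antitone_expNeg (zero_le : 0 ≤ x)

theorem continuous_expNeg : Continuous expNeg :=
  ENNReal.continuous_exp.comp (continuous_neg.comp continuous_coe_ennreal_ereal)

@[fun_prop]
theorem measurable_expNeg : Measurable expNeg := continuous_expNeg.measurable

theorem expNeg_ne_top (x : ℝ≥0∞) : expNeg x ≠ ∞ :=
  ((expNeg_le_one x).trans_lt ENNReal.one_lt_top).ne

theorem expNeg_sum {ι : Type*} (s : Finset ι) (f : ι → ℝ≥0∞) :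
    expNeg (∑ i ∈ s, f i) = ∏ i ∈ s, expNeg (f i) := by
  classical
  induction s using Finset.induction_on with
  | empty => simp [expNeg_zero]
  | insert i s hi ih => rw [Finset.sum_insert hi, Finset.prod_insert hi, expNeg_add, ih]

theorem expNeg_nsmul (n : ℕ) (x : ℝ≥0∞) : expNeg (x * n) = expNeg x ^ n := by
  have := expNeg_sum (Finset.range n) (fun _ => x)
  simpa [mul_comm] using this

theorem tendsto_expNeg_tsum (f : ℕ → ℝ≥0∞) :
    Tendsto (fun n => ∏ j ∈ Finset.range n, expNeg (f j)) atTop (𝓝 (expNeg (∑' j, f j))) := by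
  simp_rw [← expNeg_sum]
  exact (continuous_expNeg.tendsto _).comp ENNReal.summable.hasSum.tendsto_sum_nat

/-! ### The Laplace functional of a Poisson point process. -/

/-- The Poisson generating function `E[g^N] = exp (-r (1 - g))` at `g = exp (-c)`. The case `c = ∞`
is covered by `g = 0`, since `∞ * 0 = 0` matches `0 ^ 0 = 1`. -/
theorem lintegral_expNeg_poisson (r : ℝ≥0) (c : ℝ≥0∞) :
    ∫⁻ x, expNeg (c * x) ∂((poissonMeasure r).map (fun n : ℕ => (n : ℝ≥0∞))) =
      expNeg (r * (1 - expNeg c)) := by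
  rw [lintegral_map (by fun_prop) (by fun_prop), poissonMeasure, lintegral_sum_measure]
  simp_rw [lintegral_smul_measure, lintegral_dirac, expNeg_nsmul]
  set g := (expNeg c).toReal with hg
  have hgc : expNeg c = ENNReal.ofReal g := (ENNReal.ofReal_toReal (expNeg_ne_top c)).symm
  have hg0 : 0 ≤ g := ENNReal.toReal_nonneg
  have hg1 : g ≤ 1 := by
    simpa using ENNReal.toReal_mono ENNReal.one_ne_top (expNeg_le_one c)
  have hr : (r : ℝ≥0∞) = ENNReal.ofReal (r : ℝ) := by simp
  rw [hgc, hr, ← ENNReal.ofReal_one, ← ENNReal.ofReal_sub _ hg0, ← ENNReal.ofReal_mul r.coe_nonneg,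
    expNeg_ofReal (mul_nonneg r.coe_nonneg (by linarith))]
  have hs : HasSum (fun n : ℕ => Real.exp (-r) * r ^ n / n.factorial * g ^ n)
      (Real.exp (-(r * (1 - g)))) := by
    have := (NormedSpace.expSeries_div_hasSum_exp ((r : ℝ) * g)).mul_left (Real.exp (-r))
    rw [← Real.exp_eq_exp_ℝ, ← Real.exp_add] at this
    convert! this using 1
    · ext n; rw [mul_pow]; ring
    · congr 1; ring
  rw [← hs.tsum_eq, ENNReal.ofReal_tsum_of_nonneg (fun n => by positivity) hs.summable]
  refine tsum_congr fun n => ?_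
  rw [smul_eq_mul, ENNReal.ofReal_mul (by positivity), ENNReal.ofReal_pow hg0]

theorem tsum_sum_indicator_eq {Ω : Type*} (e : ℕ → Ω → Plane) {ι : Type*} [Fintype ι]
    (A : ι → Set Plane)
    (c : ι → ℝ≥0∞) (ω : Ω) :
    ∑' j, ∑ i, (A i).indicator (fun _ => c i) (e j ω) = ∑ i, c i * pointCount e (A i) ω := by
  rw [Summable.tsum_finsetSum fun _ _ => ENNReal.summable]
  refine Finset.sum_congr rfl fun i _ => ?_
  rw [pointCount, ← ENNReal.tsum_mul_left]
  refine tsum_congr fun j => ?_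
  by_cases h : e j ω ∈ A i <;> simp [h]

section LaplaceFunctional

variable {Ω : Type*} [MeasurableSpace Ω] {P : Measure Ω} {lam : ℝ} {e : ℕ → Ω → Plane}

theorem IsPoissonPointProcess.measurable_pointCount (he : IsPoissonPointProcess P lam e)
    {A : Set Plane} (hA : MeasurableSet A) : Measurable (pointCount e A) := by
  unfold pointCount
  exact Measurable.tsum fun j => (measurable_const.indicator hA).comp (he.measurable j)

theorem IsPoissonPointProcess.lintegral_expNeg_pointCount (he : IsPoissonPointProcess P lam e)
    (hlam : 0 < lam) {A : Set Plane} (hA : MeasurableSet A) (hb : Bornology.IsBounded A)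
    (c : ℝ≥0∞) :
    ∫⁻ ω, expNeg (c * pointCount e A ω) ∂P =
      expNeg (ENNReal.ofReal lam * (volume A * (1 - expNeg c))) := by
  have h := lintegral_expNeg_poisson (lam * volume.real A).toNNReal c
  rw [← (he.count_law A hA hb).map_eq,
    lintegral_map (by fun_prop) (he.measurable_pointCount hA)] at h
  rw [h, ← mul_assoc]
  congr 2
  rw [ENNReal.ofNNReal_toNNReal, ENNReal.ofReal_mul hlam.le, Measure.real,
    ENNReal.ofReal_toReal hb.measure_lt_top.ne]

/-- The Laplace functional at a combination of indicators of disjoint bounded Borel sets. -/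
theorem IsPoissonPointProcess.laplace_sum_indicator (he : IsPoissonPointProcess P lam e)
    (hlam : 0 < lam) (n : ℕ) (A : Fin n → Set Plane) (hA : ∀ i, MeasurableSet (A i))
    (hb : ∀ i, Bornology.IsBounded (A i))
    (hd : Pairwise (fun i i' => Disjoint (A i) (A i'))) (c : Fin n → ℝ≥0∞) :
    ∫⁻ ω, expNeg (∑' j, ∑ i, (A i).indicator (fun _ => c i) (e j ω)) ∂P =
      expNeg (ENNReal.ofReal lam *
        ∫⁻ x, (1 - expNeg (∑ i, (A i).indicator (fun _ => c i) x))) := by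
  -- By disjointness at most one indicator is nonzero at `x`, so the nonlinear map `1 - expNeg`
  -- passes through the sum.
  have hpt : ∀ x, 1 - expNeg (∑ i, (A i).indicator (fun _ => c i) x) =
      ∑ i, (A i).indicator (fun _ => 1 - expNeg (c i)) x := by
    intro x
    by_cases h : ∃ i, x ∈ A i
    · obtain ⟨i, hi⟩ := h
      have hne : ∀ i', i' ≠ i → x ∉ A i' := fun i' hne hx =>
        (hd hne).le_bot ⟨hx, hi⟩
      rw [Finset.sum_eq_single i (fun i' _ h => indicator_of_notMem (hne i' h) _) (by simp),
        Finset.sum_eq_single i (fun i' _ h => indicator_of_notMem (hne i' h) _) (by simp)]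
      simp [hi]
    · push Not at h
      simp [h, expNeg_zero]
  simp_rw [hpt, tsum_sum_indicator_eq, expNeg_sum]
  rw [lintegral_prod_eq_prod_lintegral_of_indepFun Finset.univ
    (fun i ω => expNeg (c i * pointCount e (A i) ω))
    ((he.count_indep n A hA hb hd).comp (fun i x => expNeg (c i * x)) fun i => by fun_prop)
    fun i => measurable_expNeg.comp ((he.measurable_pointCount (hA i)).const_mul _)]
  simp_rw [fun i => he.lintegral_expNeg_pointCount hlam (hA i) (hb i) (c i)]
  rw [← expNeg_sum, ← Finset.mul_sum, lintegral_finsetSum _ fun i _ =>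
    measurable_const.indicator (hA i)]
  congr 2
  refine Finset.sum_congr rfl fun i _ => ?_
  rw [lintegral_indicator_const (hA i), mul_comm]

/-- The level sets of `f` cut by `B` are disjoint and bounded; the cut is needed because the counts
are specified on bounded sets only. -/
theorem IsPoissonPointProcess.laplace_simpleFunc (he : IsPoissonPointProcess P lam e)
    (hlam : 0 < lam) (f : SimpleFunc Plane ℝ≥0∞) {B : Set Plane} (hB : MeasurableSet B)
    (hBb : Bornology.IsBounded B) :
    ∫⁻ ω, expNeg (∑' j, B.indicator f (e j ω)) ∂P =
      expNeg (ENNReal.ofReal lam * ∫⁻ x, (1 - expNeg (B.indicator f x))) := by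
  let φ := f.range.equivFin.symm
  have hsum : ∀ x, B.indicator f x =
      ∑ i : Fin f.range.card, (f ⁻¹' {(φ i : ℝ≥0∞)} ∩ B).indicator (fun _ => (φ i : ℝ≥0∞)) x := by
    intro x
    by_cases hx : x ∈ B
    · let i₀ := φ.symm ⟨f x, f.mem_range_self x⟩
      have hi₀ : (φ i₀ : ℝ≥0∞) = f x := by simp [i₀]
      rw [Finset.sum_eq_single i₀ _ (by simp)]
      · simp [hx, hi₀]
      · intro i _ hi
        refine indicator_of_notMem (fun h => hi ?_) _
        have h1 : f x = φ i := h.1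
        rw [← hi₀] at h1
        exact (φ.injective (Subtype.ext h1)).symm
    · simp [hx]
  simp_rw [hsum]
  refine he.laplace_sum_indicator hlam _ _ (fun i => (f.measurableSet_fiber _).inter hB)
    (fun i => hBb.subset inter_subset_right) (fun i i' hne => ?_) _
  refine Set.disjoint_left.2 fun x hx hx' => hne (φ.injective (Subtype.ext ?_))
  exact hx.1.symm.trans hx'.1

/-- The Laplace functional of a Poisson point process. -/
theorem IsPoissonPointProcess.laplace [IsFiniteMeasure P] (he : IsPoissonPointProcess P lam e)
    (hlam : 0 < lam) {f : Plane → ℝ≥0∞} (hf : Measurable f) :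
    ∫⁻ ω, expNeg (∑' j, f (e j ω)) ∂P =
      expNeg (ENNReal.ofReal lam * ∫⁻ x, (1 - expNeg (f x))) := by
  -- Simple functions cut to growing balls increase to `f`.
  let g : ℕ → Plane → ℝ≥0∞ := fun n => (Metric.ball 0 n).indicator (SimpleFunc.eapprox f n)
  have hgm : ∀ n, Measurable (g n) := fun n =>
    (SimpleFunc.measurable _).indicator Metric.isOpen_ball.measurableSet
  have hgmono : Monotone g := by
    intro m n hmn x
    refine (indicator_le_indicator_of_subset
      (Metric.ball_subset_ball (Nat.cast_le.2 hmn)) (fun _ => zero_le) x).trans ?_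
    exact indicator_le_indicator (SimpleFunc.monotone_eapprox f hmn x)
  have hglim : ∀ x, Tendsto (fun n => g n x) atTop (𝓝 (f x)) := by
    intro x
    refine (SimpleFunc.tendsto_eapprox hf x).congr' ?_
    obtain ⟨N, hN⟩ := exists_nat_gt ‖x‖
    filter_upwards [eventually_ge_atTop N] with n hn
    refine (indicator_of_mem ?_ _).symm
    have : (N : ℝ) ≤ n := by exact_mod_cast hn
    simpa using hN.trans_le this
  have hgsup : ∀ x, ⨆ n, g n x = f x := fun x =>
    tendsto_nhds_unique (tendsto_atTop_iSup fun m n h => hgmono h x) (hglim x)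
  -- Monotone convergence for the counting measure on `ℕ`.
  have hsum : ∀ ω, Tendsto (fun n => ∑' j, g n (e j ω)) atTop (𝓝 (∑' j, f (e j ω))) := by
    intro ω
    have h := lintegral_tendsto_of_tendsto_of_monotone (μ := Measure.count)
      (f := fun n j => g n (e j ω)) (F := fun j => f (e j ω))
      (fun n => Measurable.of_discrete.aemeasurable)
      (Eventually.of_forall fun j m n h => hgmono h _) (Eventually.of_forall fun j => hglim _)
    simpa [lintegral_count] using h
  have hL : Tendsto (fun n => ∫⁻ ω, expNeg (∑' j, g n (e j ω)) ∂P) atTop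
      (𝓝 (∫⁻ ω, expNeg (∑' j, f (e j ω)) ∂P)) := by
    refine tendsto_lintegral_of_dominated_convergence (fun _ => 1) (fun n => ?_)
      (fun n => Eventually.of_forall fun ω => expNeg_le_one _) (by simp)
      (Eventually.of_forall fun ω => (continuous_expNeg.tendsto _).comp (hsum ω))
    exact measurable_expNeg.comp
      (Measurable.tsum fun j => (hgm n).comp (he.measurable j))
  -- `1 - expNeg` is increasing, so monotone convergence applies even when the limit integral is
  -- infinite.
  have hR : Tendsto (fun n => ∫⁻ x, (1 - expNeg (g n x))) atTop
      (𝓝 (∫⁻ x, (1 - expNeg (f x)))) := by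
    refine lintegral_tendsto_of_tendsto_of_monotone
      (fun n => (measurable_const.sub (measurable_expNeg.comp (hgm n))).aemeasurable)
      (Eventually.of_forall fun x m n h => tsub_le_tsub_left (antitone_expNeg (hgmono h x)) _)
      (Eventually.of_forall fun x => ?_)
    exact ENNReal.Tendsto.sub tendsto_const_nhds ((continuous_expNeg.tendsto _).comp (hglim x))
      (Or.inl ENNReal.one_ne_top)
  have hR' := (continuous_expNeg.tendsto _).comp
    (ENNReal.Tendsto.const_mul hR (Or.inr (ENNReal.ofReal_ne_top (r := lam))))
  refine tendsto_nhds_unique hL (hR'.congr fun n => ?_)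
  exact (he.laplace_simpleFunc hlam _ Metric.isOpen_ball.measurableSet Metric.isBounded_ball).symm

end LaplaceFunctional

/-! ### Complex Gaussian fading. -/

theorem measurable_complex_mk : Measurable (fun p : ℝ × ℝ => (⟨p.1, p.2⟩ : ℂ)) := by
  have : Continuous (fun p : ℝ × ℝ => (⟨p.1, p.2⟩ : ℂ)) :=
    Complex.equivRealProdCLM.symm.continuous
  exact this.measurable

instance : IsProbabilityMeasure complexGaussian :=
  Measure.isProbabilityMeasure_map measurable_complex_mk.aemeasurable

theorem charFun_complexGaussian (t : ℂ) :
    charFun complexGaussian t = Complex.exp (-(‖t‖ ^ 2 / 4 : ℝ)) := by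
  have hre := charFun_gaussianReal (μ := 0) (v := 1 / 2) t.re
  have him := charFun_gaussianReal (μ := 0) (v := 1 / 2) t.im
  rw [charFun_apply] at hre him
  rw [charFun_apply, complexGaussian, integral_map measurable_complex_mk.aemeasurable
    (by fun_prop)]
  have hsplit : ∀ p : ℝ × ℝ, Complex.exp (inner ℝ (⟨p.1, p.2⟩ : ℂ) t * Complex.I) =
      Complex.exp (inner ℝ p.1 t.re * Complex.I) * Complex.exp (inner ℝ p.2 t.im * Complex.I) := by
    intro p
    rw [← Complex.exp_add, ← add_mul]
    congr 2
    rw [Complex.inner]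
    simp
  simp_rw [hsplit]
  rw [integral_prod_mul (fun x : ℝ => Complex.exp (inner ℝ x t.re * Complex.I))
    (fun x : ℝ => Complex.exp (inner ℝ x t.im * Complex.I)), hre, him, ← Complex.exp_add]
  congr 1
  rw [Complex.sq_norm, Complex.normSq_apply]
  push_cast
  simp
  ring

theorem charFun_complexGaussian_map_mul (a : ℝ) (t : ℂ) :
    charFun (complexGaussian.map (fun z => z * (a : ℂ))) t =
      Complex.exp (-(a ^ 2 * ‖t‖ ^ 2 / 4 : ℝ)) := by
  have h : (fun z : ℂ => z * (a : ℂ)) = (a • ·) := by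
    ext z; simp [mul_comm]
  rw [h, charFun_map_smul, charFun_complexGaussian, norm_smul, mul_pow, Real.norm_eq_abs, sq_abs]

section Fading

variable {Ω : Type*} [MeasurableSpace Ω] {P : Measure Ω}

/-- A real linear combination of i.i.d. `CN(0, 1)` variables is a scaled `CN(0, 1)` variable. -/
theorem map_sum_complexGaussian [IsProbabilityMeasure P] {ι : Type*} [Fintype ι] {h : ι → Ω → ℂ}
    (hm : ∀ k, Measurable (h k)) (hlaw : ∀ k, HasLaw (h k) complexGaussian P)
    (hind : iIndepFun h P) (a : ι → ℝ) :
    P.map (fun ω => ∑ k, h k ω * (a k : ℂ)) =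
      complexGaussian.map (fun z => z * ((√(∑ k, a k ^ 2) : ℝ) : ℂ)) := by
  have : IsProbabilityMeasure (P.map (fun ω => ∑ k, h k ω * (a k : ℂ))) :=
    Measure.isProbabilityMeasure_map (by fun_prop)
  have : IsProbabilityMeasure (complexGaussian.map (fun z => z * ((√(∑ k, a k ^ 2) : ℝ) : ℂ))) :=
    Measure.isProbabilityMeasure_map (by fun_prop)
  -- Both laws have characteristic function `exp (-(∑ aₖ²) ‖t‖² / 4)`.
  refine Measure.ext_of_charFun ?_
  rw [iIndepFun.charFun_map_fun_sum_eq_prod (X := fun k ω => h k ω * (a k : ℂ))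
    (fun k => by fun_prop) (hind.comp (fun k z => z * (a k : ℂ)) fun k => by fun_prop)]
  ext t
  rw [charFun_complexGaussian_map_mul, Finset.prod_apply]
  have hk : ∀ k, charFun (P.map (fun ω => h k ω * (a k : ℂ))) t =
      Complex.exp (-(a k ^ 2 * ‖t‖ ^ 2 / 4 : ℝ)) := by
    intro k
    rw [← charFun_complexGaussian_map_mul, ← (hlaw k).map_eq,
      Measure.map_map (by fun_prop) (hm k)]
    rfl
  simp_rw [hk]
  rw [← Complex.exp_sum, Real.sq_sqrt (Finset.sum_nonneg fun k _ => sq_nonneg _)]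
  congr 1
  push_cast
  rw [Finset.sum_neg_distrib, Finset.sum_mul, Finset.sum_div]

theorem lintegral_exp_neg_mul_sq_gaussianReal {c : ℝ} (hc : 0 ≤ c) :
    ∫⁻ x, ENNReal.ofReal (Real.exp (-(c * x ^ 2))) ∂(gaussianReal 0 (1 / 2)) =
      ENNReal.ofReal (√(1 + c))⁻¹ := by
  rw [← ofReal_integral_eq_lintegral_ofReal _ (Eventually.of_forall fun x => (Real.exp_pos _).le)]
  · congr 1
    rw [integral_gaussianReal_eq_integral_smul (by simp)]
    -- With variance `1 / 2` the density is `π^{-1/2} exp (-x²)`.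
    have : ∀ x : ℝ, gaussianPDFReal 0 (1 / 2) x • Real.exp (-(c * x ^ 2)) =
        (√Real.pi)⁻¹ * Real.exp (-(1 + c) * x ^ 2) := by
      intro x
      rw [gaussianPDFReal, smul_eq_mul, mul_assoc, ← Real.exp_add]
      push_cast
      congr 2
      · ring_nf
      · ring
    simp_rw [this]
    rw [integral_const_mul, integral_gaussian, Real.sqrt_div Real.pi_pos.le]
    have : √Real.pi ≠ 0 := (Real.sqrt_pos.2 Real.pi_pos).ne'
    field_simp
  · refine Integrable.mono' (integrable_const 1) (by fun_prop) (Eventually.of_forall fun x => ?_)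
    rw [Real.norm_eq_abs, abs_of_pos (Real.exp_pos _), Real.exp_le_one_iff]
    nlinarith [mul_nonneg hc (sq_nonneg x)]

/-- This is the transform of a unit exponential variable: the real and imaginary parts each
contribute a factor `(1 + c)^{-1/2}`. -/
theorem lintegral_exp_neg_mul_norm_sq_complexGaussian {c : ℝ} (hc : 0 ≤ c) :
    ∫⁻ z, ENNReal.ofReal (Real.exp (-(c * ‖z‖ ^ 2))) ∂complexGaussian =
      ENNReal.ofReal (1 + c)⁻¹ := by
  rw [complexGaussian, lintegral_map (by fun_prop) measurable_complex_mk]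
  have : ∀ p : ℝ × ℝ, ENNReal.ofReal (Real.exp (-(c * ‖(⟨p.1, p.2⟩ : ℂ)‖ ^ 2))) =
      ENNReal.ofReal (Real.exp (-(c * p.1 ^ 2))) * ENNReal.ofReal (Real.exp (-(c * p.2 ^ 2))) := by
    intro p
    rw [← ENNReal.ofReal_mul (Real.exp_pos _).le, ← Real.exp_add, Complex.sq_norm,
      Complex.normSq_apply]
    congr 2
    ring
  simp_rw [this]
  rw [lintegral_prod_mul (f := fun x : ℝ => ENNReal.ofReal (Real.exp (-(c * x ^ 2))))
    (g := fun x : ℝ => ENNReal.ofReal (Real.exp (-(c * x ^ 2)))) (by fun_prop) (by fun_prop), lintegral_exp_neg_mul_sq_gaussianReal hc,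
    ← ENNReal.ofReal_mul (by positivity), ← mul_inv, Real.mul_self_sqrt (by linarith)]

theorem lintegral_expNeg_sum_complexGaussian [IsProbabilityMeasure P] {ι : Type*} [Fintype ι]
    {h : ι → Ω → ℂ} (hm : ∀ k, Measurable (h k)) (hlaw : ∀ k, HasLaw (h k) complexGaussian P)
    (hind : iIndepFun h P) (a : ι → ℝ) {t : ℝ} (ht : 0 ≤ t) :
    ∫⁻ ω, expNeg (ENNReal.ofReal (t * ‖∑ k, h k ω * (a k : ℂ)‖ ^ 2)) ∂P =
      ENNReal.ofReal (1 + t * ∑ k, a k ^ 2)⁻¹ := by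
  have hS : 0 ≤ ∑ k, a k ^ 2 := Finset.sum_nonneg fun k _ => sq_nonneg _
  rw [← lintegral_map (μ := P) (g := fun ω => ∑ k, h k ω * (a k : ℂ))
    (f := fun z => expNeg (ENNReal.ofReal (t * ‖z‖ ^ 2))) (by fun_prop) (by fun_prop),
    map_sum_complexGaussian hm hlaw hind a, lintegral_map (by fun_prop) (by fun_prop),
    ← lintegral_exp_neg_mul_norm_sq_complexGaussian (mul_nonneg ht hS)]
  refine lintegral_congr fun z => ?_
  rw [expNeg_ofReal (by positivity), norm_mul, mul_pow, Complex.norm_real, Real.norm_eq_abs,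
    sq_abs, Real.sq_sqrt hS]
  congr 3
  ring

/-- Functions of the rows of an independent array have expectations of products that factor. -/
theorem lintegral_prod_range_rows [IsProbabilityMeasure P] {K : ℕ} {h : ℕ → Fin K → Ω → ℂ}
    (hm : ∀ j k, Measurable (h j k)) (hind : iIndepFun (fun jk : ℕ × Fin K => h jk.1 jk.2) P)
    {F : ℕ → (Fin K → ℂ) → ℝ≥0∞} (hF : ∀ j, Measurable (F j)) (n : ℕ) :
    ∫⁻ ω, ∏ j ∈ Finset.range n, F j (fun k => h j k ω) ∂P =
      ∏ j ∈ Finset.range n, ∫⁻ ω, F j (fun k => h j k ω) ∂P := by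
  induction n with
  | zero => simp
  | succ n ih =>
    simp_rw [Finset.prod_range_succ]
    rw [← ih]
    -- The rows before `n` and row `n` occupy disjoint finite blocks of indices, and functions of
    -- disjoint blocks are independent.
    let S : Finset (ℕ × Fin K) := Finset.range n ×ˢ Finset.univ
    let T : Finset (ℕ × Fin K) := {n} ×ˢ Finset.univ
    have hST : Disjoint S T := by
      rw [Finset.disjoint_left]
      rintro ⟨j, k⟩ hj hk
      simp only [S, T, Finset.mem_product, Finset.mem_range, Finset.mem_singleton] at hj hk
      omega
    have hI := hind.indepFun_finset S T hST fun jk => hm jk.1 jk.2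
    have hS : ∀ j : Finset.range n, ∀ k, ((j : ℕ), k) ∈ S := fun j k => by
      simp [S]
    have hT : ∀ k, (n, k) ∈ T := fun k => by simp [T]
    let f : (S → ℂ) → ℝ≥0∞ := fun x =>
      ∏ j : Finset.range n, F j (fun k => x ⟨((j : ℕ), k), hS j k⟩)
    let g : (T → ℂ) → ℝ≥0∞ := fun x => F n (fun k => x ⟨(n, k), hT k⟩)
    have hf : Measurable f := Finset.measurable_fun_prod _ fun j _ => (hF j).comp (by fun_prop)
    have hg : Measurable g := (hF n).comp (by fun_prop)
    have hfeq : ∀ ω, ∏ j ∈ Finset.range n, F j (fun k => h j k ω) =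
        f (fun i : S => h i.1.1 i.1.2 ω) := fun ω =>
      (Finset.prod_coe_sort (Finset.range n) fun j => F j (fun k => h j k ω)).symm
    simp_rw [hfeq]
    exact lintegral_mul_eq_lintegral_mul_lintegral_of_indepFun'
      (by fun_prop) (by fun_prop) (hI.comp hf hg)

end Fading

/-! ### Averaging over the fading, then over the positions. -/

/-- The Laplace transform of the SNR of an eavesdropper at `x` is `1 / (1 + meanSNR x)`, where
`meanSNR x` is `c ∑ₖ |x - bₖ|^{-α}`. -/
noncomputable def meanSNR {K : ℕ} (b : Fin K → Plane) (α c : ℝ) (x : Plane) : ℝ :=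
  c * ∑ k, dist x (b k) ^ (-α)

theorem meanSNR_nonneg {K : ℕ} (b : Fin K → Plane) (α : ℝ) {c : ℝ} (hc : 0 ≤ c) (x : Plane) :
    0 ≤ meanSNR b α c x :=
  mul_nonneg hc (Finset.sum_nonneg fun _ _ => Real.rpow_nonneg dist_nonneg _)

@[fun_prop]
theorem measurable_meanSNR {K : ℕ} (b : Fin K → Plane) (α c : ℝ) :
    Measurable (meanSNR b α c) := by
  unfold meanSNR
  fun_prop

/-- Turns the product of the factors `1 / (1 + u)` into `expNeg` of a sum over the points, the form
required by the Laplace functional. -/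
theorem expNeg_log_one_add {u : ℝ} (hu : 0 ≤ u) :
    expNeg (ENNReal.ofReal (Real.log (1 + u))) = ENNReal.ofReal (1 + u)⁻¹ := by
  rw [expNeg_ofReal (Real.log_nonneg (by linarith)), Real.exp_neg, Real.exp_log (by linarith)]

section Model

variable {Ω : Type*} [MeasurableSpace Ω] {P : Measure Ω}

/-- The Laplace transform of the aggregate SNR for deterministic amplitudes. -/
theorem lintegral_expNeg_tsum_rows [IsProbabilityMeasure P] {K : ℕ} {h : ℕ → Fin K → Ω → ℂ}
    (hm : ∀ j k, Measurable (h j k)) (hlaw : ∀ j k, HasLaw (h j k) complexGaussian P)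
    (hind : iIndepFun (fun jk : ℕ × Fin K => h jk.1 jk.2) P) (a : ℕ → Fin K → ℝ) {t : ℝ}
    (ht : 0 ≤ t) :
    ∫⁻ ω, expNeg (∑' j, ENNReal.ofReal (t * ‖∑ k, h j k ω * (a j k : ℂ)‖ ^ 2)) ∂P =
      expNeg (∑' j, ENNReal.ofReal (Real.log (1 + t * ∑ k, a j k ^ 2))) := by
  have hS : ∀ j, 0 ≤ t * ∑ k, a j k ^ 2 := fun j =>
    mul_nonneg ht (Finset.sum_nonneg fun k _ => sq_nonneg _)
  have hL : Tendsto (fun n => ∫⁻ ω, ∏ j ∈ Finset.range n,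
      expNeg (ENNReal.ofReal (t * ‖∑ k, h j k ω * (a j k : ℂ)‖ ^ 2)) ∂P) atTop
      (𝓝 (∫⁻ ω, expNeg (∑' j, ENNReal.ofReal (t * ‖∑ k, h j k ω * (a j k : ℂ)‖ ^ 2)) ∂P)) := by
    refine tendsto_lintegral_of_dominated_convergence (fun _ => 1) (fun n => by fun_prop)
      (fun n => Eventually.of_forall fun ω => ?_) (by simp)
      (Eventually.of_forall fun ω => tendsto_expNeg_tsum _)
    exact Finset.prod_le_one' fun j _ => expNeg_le_one _
  refine tendsto_nhds_unique hL ((tendsto_expNeg_tsum _).congr fun n => ?_)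
  rw [lintegral_prod_range_rows hm hind
    (F := fun j z => expNeg (ENNReal.ofReal (t * ‖∑ k, z k * (a j k : ℂ)‖ ^ 2)))
    (fun j => by fun_prop)]
  refine Finset.prod_congr rfl fun j _ => ?_
  rw [lintegral_expNeg_sum_complexGaussian (hm j) (hlaw j)
    (hind.precomp (g := fun k => (j, k)) (Prod.mk_right_injective j)) _ ht,
    expNeg_log_one_add (hS j)]

variable {K : ℕ} {rb θb : Fin K → ℝ} {α ρ lam : ℝ} {e : ℕ → Ω → Plane} {h : ℕ → Fin K → Ω → ℂ}

theorem IsRayleighPoissonModel.measurable_snr (hmodel : IsRayleighPoissonModel P K lam e h)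
    (j : ℕ) : Measurable (snr rb θb α ρ e h j) := by
  have := hmodel.poisson.measurable
  have := hmodel.fading_measurable
  unfold snr
  fun_prop

theorem IsRayleighPoissonModel.measurable_aggregateSNR
    (hmodel : IsRayleighPoissonModel P K lam e h) :
    Measurable (aggregateSNR rb θb α ρ e h) :=
  Measurable.tsum fun j => (hmodel.measurable_snr j).ennreal_ofReal

/-- Averaging over the fading, conditionally on the positions of the eavesdroppers. -/
theorem IsRayleighPoissonModel.laplaceTransform_eq_lintegral_points [IsProbabilityMeasure P]
    (hmodel : IsRayleighPoissonModel P K lam e h) (hρ : 0 < ρ) {s : ℝ} (hs : 0 ≤ s) :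
    laplaceTransform P (aggregateSNR rb θb α ρ e h) s =
      ∫⁻ ω, expNeg (∑' j, ENNReal.ofReal
        (Real.log (1 + meanSNR (fun k => polarPoint (rb k) (θb k)) α (s * ρ) (e j ω)))) ∂P := by
  have hem := hmodel.poisson.measurable
  have hhm := hmodel.fading_measurable
  set b : Fin K → Plane := fun k => polarPoint (rb k) (θb k) with hb
  -- As a function of fading and positions separately, `G` can be integrated against the product of
  -- the two laws, by Tonelli with the positions frozen.
  let G : (ℕ × Fin K → ℂ) × (ℕ → Plane) → ℝ≥0∞ := fun q =>
    expNeg (∑' j, ENNReal.ofReal (s * ρ *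
      ‖∑ k, q.1 (j, k) * ((dist (q.2 j) (b k) ^ (-α / 2) : ℝ) : ℂ)‖ ^ 2))
  have hG : Measurable G := measurable_expNeg.comp (Measurable.tsum fun j => by fun_prop)
  have hH : Measurable (fun ω (jk : ℕ × Fin K) => h jk.1 jk.2 ω) := by fun_prop
  have hE : Measurable (fun ω j => e j ω) := by fun_prop
  have hmap := hmodel.fading_indep_points.map_prod_eq_prod_map_map hH.aemeasurable hE.aemeasurable
  have : IsProbabilityMeasure (P.map (fun ω (jk : ℕ × Fin K) => h jk.1 jk.2 ω)) :=
    Measure.isProbabilityMeasure_map hH.aemeasurable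
  have : IsProbabilityMeasure (P.map (fun ω j => e j ω)) :=
    Measure.isProbabilityMeasure_map hE.aemeasurable
  have hinner : ∀ x : ℕ → Plane, ∫⁻ ω, G (fun jk => h jk.1 jk.2 ω, x) ∂P =
      expNeg (∑' j, ENNReal.ofReal (Real.log (1 + meanSNR b α (s * ρ) (x j)))) := by
    intro x
    rw [lintegral_expNeg_tsum_rows hhm hmodel.fading_law hmodel.fading_indep
      (fun j k => dist (x j) (b k) ^ (-α / 2)) (mul_nonneg hs hρ.le)]
    congr 1
    refine tsum_congr fun j => ?_
    rw [meanSNR]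
    congr 5
    ext k
    -- `(d^{-α/2})² = d^{-α}` holds for real powers even at `d = 0`, so points at a station need no
    -- exception.
    rw [← Real.rpow_mul_natCast dist_nonneg]
    congr 1
    push_cast
    ring
  calc laplaceTransform P (aggregateSNR rb θb α ρ e h) s
      = ∫⁻ ω, G (fun jk => h jk.1 jk.2 ω, fun j => e j ω) ∂P := by
        refine lintegral_congr fun ω => ?_
        simp only [G, aggregateSNR, ← ENNReal.tsum_mul_left, snr]
        congr 1
        refine tsum_congr fun j => ?_
        rw [← ENNReal.ofReal_mul hs, ← mul_assoc]
    _ = ∫⁻ q, G q ∂(P.map (fun ω => ((fun jk : ℕ × Fin K => h jk.1 jk.2 ω), fun j => e j ω))) :=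
        (lintegral_map hG (hH.prodMk hE)).symm
    _ = ∫⁻ x, ∫⁻ η, G (η, x) ∂(P.map (fun ω (jk : ℕ × Fin K) => h jk.1 jk.2 ω))
          ∂(P.map (fun ω j => e j ω)) := by
        rw [hmap, lintegral_prod_symm' _ hG]
    _ = ∫⁻ ω, ∫⁻ η, G (η, fun j => e j ω) ∂(P.map (fun ω (jk : ℕ × Fin K) => h jk.1 jk.2 ω)) ∂P :=
        lintegral_map hG.lintegral_prod_left' hE
    _ = _ := by
        refine lintegral_congr fun ω => ?_
        rw [lintegral_map (by fun_prop) hH]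
        exact hinner _

/-- With `f = log (1 + u)`, the integrand `1 - exp (-f)` of the Laplace functional is `u / (1 + u)`.
-/
theorem IsRayleighPoissonModel.laplaceTransform_eq [IsProbabilityMeasure P]
    (hmodel : IsRayleighPoissonModel P K lam e h) (hρ : 0 < ρ) (hlam : 0 < lam)
    {s : ℝ} (hs : 0 ≤ s) :
    laplaceTransform P (aggregateSNR rb θb α ρ e h) s =
      expNeg (ENNReal.ofReal lam * ∫⁻ x, ENNReal.ofReal
        (meanSNR (fun k => polarPoint (rb k) (θb k)) α (s * ρ) x /
          (1 + meanSNR (fun k => polarPoint (rb k) (θb k)) α (s * ρ) x))) := by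
  rw [hmodel.laplaceTransform_eq_lintegral_points hρ hs,
    hmodel.poisson.laplace hlam (f := fun x => ENNReal.ofReal
      (Real.log (1 + meanSNR (fun k => polarPoint (rb k) (θb k)) α (s * ρ) x))) (by fun_prop)]
  congr 2
  refine lintegral_congr fun x => ?_
  have hu := meanSNR_nonneg (fun k => polarPoint (rb k) (θb k)) α (mul_nonneg hs hρ.le) x
  rw [expNeg_log_one_add hu, ← ENNReal.ofReal_one, ← ENNReal.ofReal_sub _ (by positivity)]
  congr 1
  field_simp
  ring

end Model

/-! ### Polar coordinates and the reflection symmetry. -/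

theorem lintegral_plane (f : Plane → ℝ≥0∞) (hf : Measurable f) :
    ∫⁻ x, f x = ∫⁻ p : ℝ × ℝ, f !₂[p.1, p.2] := by
  rw [← (PiLp.volume_preserving_toLp (Fin 2)).lintegral_comp hf,
    ← ((volume_preserving_finTwoArrow ℝ).symm _).lintegral_comp (by fun_prop)]
  rfl

theorem measurable_polarPoint : Measurable (fun p : ℝ × ℝ => polarPoint p.1 p.2) := by
  unfold polarPoint
  refine (PiLp.continuous_toLp 2 _).measurable.comp (measurable_pi_lambda _ fun i => ?_)
  fin_cases i
  · change Measurable fun p : ℝ × ℝ => p.1 * Real.cos p.2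
    fun_prop
  · change Measurable fun p : ℝ × ℝ => p.1 * Real.sin p.2
    fun_prop

theorem lintegral_plane_polar (f : Plane → ℝ≥0∞) (hf : Measurable f) :
    ∫⁻ x, f x = ∫⁻ r in Ioi (0 : ℝ), ∫⁻ θ in Ioo (-Real.pi) Real.pi,
      ENNReal.ofReal r * f (polarPoint r θ) := by
  rw [lintegral_plane f hf, ← lintegral_comp_polarCoord_symm, polarCoord_target,
    Measure.volume_eq_prod, ← Measure.prod_restrict]
  have := hf.comp measurable_polarPoint
  refine (lintegral_prod _ ?_)
  refine Measurable.aemeasurable ?_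
  exact (by fun_prop : Measurable fun p : ℝ × ℝ => ENNReal.ofReal p.1).mul this

theorem lintegral_Ioo_comp_neg (g : ℝ → ℝ≥0∞) (a : ℝ) :
    ∫⁻ θ in Ioo (-a) 0, g (-θ) = ∫⁻ θ in Ioo 0 a, g θ := by
  have h := (Measure.measurePreserving_neg (volume : Measure ℝ)).setLIntegral_comp_preimage_emb
    (MeasurableEquiv.neg ℝ).measurableEmbedding g (Ioo 0 a)
  rw [← h]
  congr 2
  ext x
  simp

theorem lintegral_Ioo_eq_add (g : ℝ → ℝ≥0∞) {a : ℝ} (ha : 0 < a) :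
    ∫⁻ θ in Ioo (-a) a, g θ = (∫⁻ θ in Ioo (-a) 0, g θ) + ∫⁻ θ in Ioo 0 a, g θ := by
  rw [setLIntegral_congr Ioo_ae_eq_Ioc, setLIntegral_congr (Ioo_ae_eq_Ioc (a := -a) (b := 0)),
    setLIntegral_congr (Ioo_ae_eq_Ioc (a := 0) (b := a)),
    ← Ioc_union_Ioc_eq_Ioc (by linarith : -a ≤ 0) ha.le,
    lintegral_union measurableSet_Ioc (Ioc_disjoint_Ioc_of_le le_rfl)]

/-- The polar chart has angles in `(-π, π)`. Up to null sets both intervals are fundamental domains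
for translation by `2π`. -/
theorem lintegral_periodic_shift (g : ℝ → ℝ≥0∞) (hg : Function.Periodic g (2 * Real.pi)) :
    ∫⁻ θ in Ioo (-Real.pi) Real.pi, g θ = ∫⁻ θ in Ioo 0 (2 * Real.pi), g θ := by
  have h1 := isAddFundamentalDomain_Ioc Real.two_pi_pos (-Real.pi)
  have h2 := isAddFundamentalDomain_Ioc Real.two_pi_pos 0
  have h := h1.setLIntegral_eq h2 g hg.map_vadd_zmultiples
  rw [setLIntegral_congr Ioo_ae_eq_Ioc, setLIntegral_congr (Ioo_ae_eq_Ioc (a := 0))]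
  rw [zero_add, show -Real.pi + 2 * Real.pi = Real.pi by ring] at h
  exact h

theorem dist_polarPoint (r₀ θ₀ r θ : ℝ) :
    dist (polarPoint r θ) (polarPoint r₀ θ₀) = polarDist r₀ θ₀ r θ := by
  rw [EuclideanSpace.dist_eq, polarDist]
  congr 1
  simp only [polarPoint, Fin.sum_univ_two, Real.dist_eq, sq_abs]
  simp
  rw [Real.cos_sub]
  linear_combination r ^ 2 * Real.sin_sq_add_cos_sq θ + r₀ ^ 2 * Real.sin_sq_add_cos_sq θ₀

theorem integrand_eq {K : ℕ} (rb θb : Fin K → ℝ) (α ρ s r θ : ℝ) :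
    integrand rb θb α ρ s r θ =
      meanSNR (fun k => polarPoint (rb k) (θb k)) α (s * ρ) (polarPoint r θ) /
        (1 + meanSNR (fun k => polarPoint (rb k) (θb k)) α (s * ρ) (polarPoint r θ)) := by
  simp_rw [integrand, meanSNR, dist_polarPoint]

theorem polarPoint_add_two_pi (r θ : ℝ) : polarPoint r (θ + 2 * Real.pi) = polarPoint r θ := by
  simp [polarPoint]

theorem polarDist_neg (r₀ θ₀ r θ : ℝ) : polarDist r₀ θ₀ r (-θ) = polarDist r₀ (-θ₀) r θ := by
  rw [polarDist, polarDist, ← Real.cos_neg]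
  ring_nf

theorem IsAxiallySymmetric.integrand_neg {K : ℕ} {rb θb : Fin K → ℝ}
    (hsym : IsAxiallySymmetric rb θb) (α ρ s r θ : ℝ) :
    integrand rb θb α ρ s r (-θ) = integrand rb θb α ρ s r θ := by
  obtain ⟨σ, hσ⟩ := hsym
  have h : ∑ k, polarDist (rb k) (θb k) r (-θ) ^ (-α) =
      ∑ k, polarDist (rb k) (θb k) r θ ^ (-α) := by
    -- Reflecting the point amounts to reflecting the stations, which only permutes them by `σ`.
    rw [← Equiv.sum_comp σ fun k => polarDist (rb k) (θb k) r θ ^ (-α)]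
    refine Finset.sum_congr rfl fun k _ => ?_
    rw [polarDist_neg, ← dist_polarPoint, ← dist_polarPoint, hσ]
  rw [integrand, integrand, h]

theorem integrand_nonneg {K : ℕ} (rb θb : Fin K → ℝ) (α r θ : ℝ) {ρ s : ℝ} (hρ : 0 < ρ)
    (hs : 0 ≤ s) : 0 ≤ integrand rb θb α ρ s r θ := by
  rw [integrand_eq]
  have := meanSNR_nonneg (fun k => polarPoint (rb k) (θb k)) α (mul_nonneg hs hρ.le)
    (polarPoint r θ)
  positivity

theorem measurable_integrand {K : ℕ} (rb θb : Fin K → ℝ) (α ρ s : ℝ) :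
    Measurable (fun p : ℝ × ℝ => integrand rb θb α ρ s p.1 p.2) := by
  unfold integrand polarDist
  fun_prop

theorem lintegral_plane_eq_lintegral_integrand {K : ℕ} (rb θb : Fin K → ℝ) (α ρ s : ℝ) :
    ∫⁻ x, ENNReal.ofReal (meanSNR (fun k => polarPoint (rb k) (θb k)) α (s * ρ) x /
        (1 + meanSNR (fun k => polarPoint (rb k) (θb k)) α (s * ρ) x)) =
      ∫⁻ r in Ioi (0 : ℝ), ∫⁻ θ in Ioo (0 : ℝ) (2 * Real.pi),
        ENNReal.ofReal (integrand rb θb α ρ s r θ * r) := by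
  rw [lintegral_plane_polar _ (by fun_prop)]
  refine setLIntegral_congr_fun measurableSet_Ioi fun r hr => ?_
  rw [← lintegral_periodic_shift]
  · refine lintegral_congr fun θ => ?_
    rw [integrand_eq, mul_comm _ r, ENNReal.ofReal_mul (le_of_lt hr)]
  · intro θ
    simp_rw [integrand_eq, polarPoint_add_two_pi]

theorem IsAxiallySymmetric.lintegral_integrand {K : ℕ} {rb θb : Fin K → ℝ}
    (hsym : IsAxiallySymmetric rb θb) (α ρ s r : ℝ) :
    ∫⁻ θ in Ioo (0 : ℝ) (2 * Real.pi), ENNReal.ofReal (integrand rb θb α ρ s r θ * r) =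
      2 * ∫⁻ θ in Ioo (0 : ℝ) Real.pi, ENNReal.ofReal (integrand rb θb α ρ s r θ * r) := by
  rw [← lintegral_periodic_shift, lintegral_Ioo_eq_add _ Real.pi_pos, two_mul]
  · congr 1
    rw [← lintegral_Ioo_comp_neg]
    simp_rw [hsym.integrand_neg]
  · intro θ
    simp_rw [integrand_eq, polarPoint_add_two_pi]

/-! ### Integrability for exponents above two. -/

/-- For `d > 0` the left side is `c / (d^α + c)`, with no singularity at `0`; the majorant keeps its
decay at infinity. -/
theorem mul_rpow_neg_div_one_add_le {α c d : ℝ} (hα : 0 < α) (hc : 0 ≤ c) (hd : 0 ≤ d) :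
    c * d ^ (-α) / (1 + c * d ^ (-α)) ≤ 2 ^ α * (1 + c) * (1 + d) ^ (-α) := by
  rcases hd.eq_or_lt with rfl | hd
  · rw [Real.zero_rpow (by linarith)]
    have : (0 : ℝ) < (1 + 0) ^ (-α) := by positivity
    simp only [mul_zero, zero_div]
    positivity
  have hp : 0 < d ^ α := Real.rpow_pos_of_pos hd α
  have hq : 0 < (1 + d) ^ α := by positivity
  have h2 : (0 : ℝ) < 2 ^ α := by positivity
  -- From `1 + d ≤ 2 max(1, d)`.
  have hle : (1 + d) ^ α ≤ 2 ^ α * (1 + d ^ α) := by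
    rcases le_total d 1 with h | h
    · calc (1 + d) ^ α ≤ 2 ^ α := Real.rpow_le_rpow (by linarith) (by linarith) hα.le
        _ ≤ 2 ^ α * (1 + d ^ α) := by nlinarith
    · calc (1 + d) ^ α ≤ (2 * d) ^ α := Real.rpow_le_rpow (by linarith) (by linarith) hα.le
        _ = 2 ^ α * d ^ α := Real.mul_rpow (by norm_num) hd.le
        _ ≤ 2 ^ α * (1 + d ^ α) := by nlinarith
  have hlhs : c * d ^ (-α) / (1 + c * d ^ (-α)) = c / (d ^ α + c) := by
    rw [Real.rpow_neg hd.le]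
    field_simp
  rw [hlhs, Real.rpow_neg (by linarith), ← div_eq_mul_inv, div_le_div_iff₀ (by linarith) hq]
  calc c * (1 + d) ^ α ≤ c * (2 ^ α * (1 + d ^ α)) := mul_le_mul_of_nonneg_left hle hc
    _ = 2 ^ α * (c + c * d ^ α) := by ring
    _ ≤ 2 ^ α * ((1 + c) * (d ^ α + c)) := by
      refine mul_le_mul_of_nonneg_left ?_ h2.le
      nlinarith [mul_self_nonneg c]
    _ = 2 ^ α * (1 + c) * (d ^ α + c) := by ring

theorem meanSNR_div_le {K : ℕ} (b : Fin K → Plane) {α c : ℝ} (hα : 0 < α) (hc : 0 ≤ c)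
    (x : Plane) :
    meanSNR b α c x / (1 + meanSNR b α c x) ≤
      ∑ k, 2 ^ α * (1 + c) * (1 + ‖x - b k‖) ^ (-α) := by
  have hk : ∀ k, 0 ≤ c * dist x (b k) ^ (-α) := fun k =>
    mul_nonneg hc (Real.rpow_nonneg dist_nonneg _)
  simp_rw [← dist_eq_norm]
  have hu : meanSNR b α c x = ∑ k, c * dist x (b k) ^ (-α) := Finset.mul_sum _ _ _
  rw [hu, Finset.sum_div]
  refine Finset.sum_le_sum fun k _ => le_trans ?_
    (mul_rpow_neg_div_one_add_le hα hc dist_nonneg)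
  -- Keeping only the `k`-th term in the denominator enlarges the fraction.
  refine div_le_div_of_nonneg_left (hk k) (by linarith [hk k]) ?_
  have := Finset.single_le_sum (f := fun k => c * dist x (b k) ^ (-α)) (fun k _ => hk k)
    (Finset.mem_univ k)
  linarith

theorem lintegral_meanSNR_div_lt_top {K : ℕ} (b : Fin K → Plane) {α c : ℝ} (hα : 2 < α)
    (hc : 0 ≤ c) :
    ∫⁻ x, ENNReal.ofReal (meanSNR b α c x / (1 + meanSNR b α c x)) < ∞ := by
  have hint : Integrable (fun x : Plane => ∑ k, 2 ^ α * (1 + c) * (1 + ‖x - b k‖) ^ (-α)) := by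
    refine integrable_finsetSum _ fun k _ => Integrable.const_mul ?_ _
    have h : Integrable (fun x : Plane => (1 + ‖x‖) ^ (-α)) :=
      -- The threshold `2` is the dimension of the plane.
      integrable_one_add_norm (by simpa using hα)
    exact h.comp_sub_right (b k)
  refine lt_of_le_of_lt (lintegral_mono fun x => ENNReal.ofReal_le_ofReal
    (meanSNR_div_le b (by linarith) hc x)) ?_
  exact hint.lintegral_lt_top

/-- The exponent of the transform vanishes as `s = 1 / (n + 1) → 0`, by dominated convergence with
the integrand at `s = 1` as majorant. -/
theorem tendsto_lintegral_meanSNR_div {K : ℕ} (b : Fin K → Plane) {α ρ : ℝ} (hα : 2 < α)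
    (hρ : 0 < ρ) :
    Tendsto (fun n : ℕ => ∫⁻ x, ENNReal.ofReal (meanSNR b α (1 / ((n : ℝ) + 1) * ρ) x /
      (1 + meanSNR b α (1 / ((n : ℝ) + 1) * ρ) x))) atTop (𝓝 0) := by
  have h := tendsto_lintegral_of_dominated_convergence (μ := (volume : Measure Plane))
    (F := fun (n : ℕ) x => ENNReal.ofReal (meanSNR b α (1 / ((n : ℝ) + 1) * ρ) x /
      (1 + meanSNR b α (1 / ((n : ℝ) + 1) * ρ) x))) (f := fun _ => 0)
    (fun x => ENNReal.ofReal (meanSNR b α ρ x / (1 + meanSNR b α ρ x)))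
    (fun n => by fun_prop) (fun n => Eventually.of_forall fun x => ENNReal.ofReal_le_ofReal ?_)
    (lintegral_meanSNR_div_lt_top b hα hρ.le).ne (Eventually.of_forall fun x => ?_)
  · simpa using h
  · have hn : (1 : ℝ) / (n + 1) ≤ 1 := by
      rw [div_le_one (by positivity)]
      linarith [(n.cast_nonneg : (0 : ℝ) ≤ n)]
    have h0 := meanSNR_nonneg b α (c := 1 / ((n : ℝ) + 1) * ρ) (by positivity) x
    have h1 := meanSNR_nonneg b α hρ.le x
    have hle : meanSNR b α (1 / ((n : ℝ) + 1) * ρ) x ≤ meanSNR b α ρ x := by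
      rw [show meanSNR b α (1 / ((n : ℝ) + 1) * ρ) x = 1 / ((n : ℝ) + 1) * meanSNR b α ρ x by
        unfold meanSNR; ring]
      exact mul_le_of_le_one_left h1 hn
    rw [div_le_div_iff₀ (by linarith) (by linarith)]
    nlinarith
  · have hlim : Tendsto (fun n : ℕ => 1 / ((n : ℝ) + 1) * ρ) atTop (𝓝 0) := by
      simpa using tendsto_one_div_add_atTop_nhds_zero_nat.mul_const ρ
    have hu : Tendsto (fun n : ℕ => meanSNR b α (1 / ((n : ℝ) + 1) * ρ) x) atTop (𝓝 0) := by
      simpa [meanSNR] using hlim.mul_const (∑ k, dist x (b k) ^ (-α))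
    have := hu.div (hu.const_add 1) (by norm_num)
    simpa using ENNReal.tendsto_ofReal this

/-! ### Almost sure finiteness and passage to real-valued integrals. -/

section Finite

variable {Ω : Type*}
variable {K : ℕ} {rb θb : Fin K → ℝ} {α ρ lam : ℝ} {e : ℕ → Ω → Plane} {h : ℕ → Fin K → Ω → ℂ}

theorem snr_nonneg (hρ : 0 < ρ) (j : ℕ) (ω : Ω) : 0 ≤ snr rb θb α ρ e h j ω := by
  unfold snr
  positivity

theorem summable_snr (hρ : 0 < ρ) {ω : Ω} (hω : aggregateSNR rb θb α ρ e h ω ≠ ∞) :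
    Summable fun j => snr rb θb α ρ e h j ω := by
  refine (ENNReal.summable_toReal hω).congr fun j => ?_
  exact ENNReal.toReal_ofReal (snr_nonneg hρ j ω)

theorem toReal_expNeg_aggregateSNR (hρ : 0 < ρ) {s : ℝ} (hs : 0 ≤ s) {ω : Ω}
    (hω : aggregateSNR rb θb α ρ e h ω ≠ ∞) :
    (expNeg (ENNReal.ofReal s * aggregateSNR rb θb α ρ e h ω)).toReal =
      Real.exp (-s * ∑' j, snr rb θb α ρ e h j ω) := by
  have hnn := fun j => snr_nonneg (rb := rb) (θb := θb) (α := α) (e := e) (h := h) hρ j ω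
  rw [aggregateSNR, ← ENNReal.ofReal_tsum_of_nonneg hnn (summable_snr hρ hω),
    ← ENNReal.ofReal_mul hs, expNeg_ofReal (mul_nonneg hs (tsum_nonneg hnn)),
    ENNReal.toReal_ofReal (Real.exp_pos _).le, neg_mul]

variable [MeasurableSpace Ω] {P : Measure Ω}

/-- Where `X = ∞` the integrand is `exp (-∞) = 0`; this needs `s > 0`, since `0 * ∞ = 0`. -/
theorem laplaceTransform_le_measure_ne_top {X : Ω → ℝ≥0∞} (hX : Measurable X) {s : ℝ}
    (hs : 0 < s) : laplaceTransform P X s ≤ P {ω | X ω ≠ ∞} := by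
  have hm : MeasurableSet {ω | X ω ≠ ∞} := (hX (measurableSet_singleton ∞)).compl
  rw [laplaceTransform, ← lintegral_indicator_one hm]
  refine lintegral_mono fun ω => ?_
  by_cases h : X ω = ∞
  · simp [h, ENNReal.mul_top, hs, expNeg_top]
  · simpa [h] using expNeg_le_one _

theorem IsRayleighPoissonModel.ae_aggregateSNR_ne_top [IsProbabilityMeasure P]
    (hmodel : IsRayleighPoissonModel P K lam e h) (hρ : 0 < ρ) (hlam : 0 < lam) (hα : 2 < α) :
    ∀ᵐ ω ∂P, aggregateSNR rb θb α ρ e h ω ≠ ∞ := by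
  have hX := hmodel.measurable_aggregateSNR (rb := rb) (θb := θb) (α := α) (ρ := ρ)
  have hm : MeasurableSet {ω | aggregateSNR rb θb α ρ e h ω ≠ ∞} :=
    (hX (measurableSet_singleton ∞)).compl
  refine (mem_ae_iff_prob_eq_one hm).2 (le_antisymm prob_le_one ?_)
  have hlim := (continuous_expNeg.tendsto _).comp (ENNReal.Tendsto.const_mul
    (tendsto_lintegral_meanSNR_div (fun k => polarPoint (rb k) (θb k)) hα hρ)
    (Or.inr (ENNReal.ofReal_ne_top (r := lam))))
  rw [mul_zero, expNeg_zero] at hlim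
  -- The probability of finiteness dominates the transform at every `s = 1 / (n + 1)`, and these
  -- values tend to `1`.
  refine le_of_tendsto' hlim fun n => ?_
  have hn : (0 : ℝ) < 1 / ((n : ℝ) + 1) := by positivity
  rw [Function.comp_apply, ← hmodel.laplaceTransform_eq hρ hlam hn.le]
  exact laplaceTransform_le_measure_ne_top hX hn

theorem IsRayleighPoissonModel.integrable_exp_and_integral [IsProbabilityMeasure P]
    (hmodel : IsRayleighPoissonModel P K lam e h) (hρ : 0 < ρ) (hlam : 0 < lam) (hα : 2 < α)
    {s : ℝ} (hs : 0 ≤ s) :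
    Integrable (fun ω => Real.exp (-s * ∑' j, snr rb θb α ρ e h j ω)) P ∧
      ∫ ω, Real.exp (-s * ∑' j, snr rb θb α ρ e h j ω) ∂P =
        (laplaceTransform P (aggregateSNR rb θb α ρ e h) s).toReal := by
  have hX := hmodel.measurable_aggregateSNR (rb := rb) (θb := θb) (α := α) (ρ := ρ)
  have hm : Measurable fun ω => expNeg (ENNReal.ofReal s * aggregateSNR rb θb α ρ e h ω) := by
    fun_prop
  have hae : (fun ω => (expNeg (ENNReal.ofReal s * aggregateSNR rb θb α ρ e h ω)).toReal) =ᵐ[P]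
      fun ω => Real.exp (-s * ∑' j, snr rb θb α ρ e h j ω) := by
    -- Where the series diverges the real `∑'` is `0` by convention, but this happens only on a null
    -- set.
    filter_upwards [hmodel.ae_aggregateSNR_ne_top hρ hlam hα] with ω hω
    exact toReal_expNeg_aggregateSNR hρ hs hω
  have hfin : ∫⁻ ω, expNeg (ENNReal.ofReal s * aggregateSNR rb θb α ρ e h ω) ∂P ≠ ∞ :=
    ((lintegral_mono fun ω => expNeg_le_one _).trans_lt (by simp)).ne
  refine ⟨(integrable_toReal_of_lintegral_ne_top hm.aemeasurable hfin).congr hae, ?_⟩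
  rw [← integral_congr_ae hae, laplaceTransform]
  exact integral_toReal hm.aemeasurable
    (Eventually.of_forall fun ω => (expNeg_ne_top _).lt_top)

end Finite

/-- Passing from iterated lower integrals to Bochner integrals on a half-strip. -/
theorem integrableOn_and_integral_strip {f : ℝ → ℝ → ℝ} {a : ℝ} (ha : 0 ≤ a)
    (hf : Measurable fun p : ℝ × ℝ => f p.1 p.2) (h0 : ∀ r, 0 < r → ∀ θ, 0 ≤ f r θ)
    (hfin : ∫⁻ r in Ioi (0 : ℝ), ∫⁻ θ in Ioo 0 a, ENNReal.ofReal (f r θ) ≠ ∞) :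
    IntegrableOn (fun p : ℝ × ℝ => f p.1 p.2) (Ioi (0 : ℝ) ×ˢ Ioo 0 a) ∧
      ∫ r in Ioi (0 : ℝ), ∫ θ in (0 : ℝ)..a, f r θ =
        (∫⁻ r in Ioi (0 : ℝ), ∫⁻ θ in Ioo 0 a, ENNReal.ofReal (f r θ)).toReal := by
  have hprod : ∫⁻ p in Ioi (0 : ℝ) ×ˢ Ioo 0 a, ENNReal.ofReal (f p.1 p.2) =
      ∫⁻ r in Ioi (0 : ℝ), ∫⁻ θ in Ioo 0 a, ENNReal.ofReal (f r θ) := by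
    rw [Measure.volume_eq_prod, ← Measure.prod_restrict]
    exact lintegral_prod _ hf.ennreal_ofReal.aemeasurable
  have hS : MeasurableSet (Ioi (0 : ℝ) ×ˢ Ioo 0 a) := measurableSet_Ioi.prod measurableSet_Ioo
  have hae : 0 ≤ᵐ[volume.restrict (Ioi (0 : ℝ) ×ˢ Ioo 0 a)] fun p : ℝ × ℝ => f p.1 p.2 :=
    (ae_restrict_iff' hS).2 (Eventually.of_forall fun p hp => h0 _ hp.1 _)
  have hint : IntegrableOn (fun p : ℝ × ℝ => f p.1 p.2) (Ioi (0 : ℝ) ×ˢ Ioo 0 a) :=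
    (lintegral_ofReal_ne_top_iff_integrable hf.aestronglyMeasurable hae).1 (hprod ▸ hfin)
  refine ⟨hint, ?_⟩
  rw [← hprod, ← integral_eq_lintegral_of_nonneg_ae hae hf.aestronglyMeasurable]
  rw [Measure.volume_eq_prod] at hint ⊢
  rw [setIntegral_prod _ hint]
  refine integral_congr_ae (Eventually.of_forall fun r => ?_)
  simp only
  rw [intervalIntegral.integral_of_le ha, integral_Ioc_eq_integral_Ioo]

theorem toReal_expNeg_ofReal_mul {c : ℝ} (hc : 0 ≤ c) {J : ℝ≥0∞} (hJ : J ≠ ∞) :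
    (expNeg (ENNReal.ofReal c * J)).toReal = Real.exp (-c * J.toReal) := by
  conv_lhs => rw [← ENNReal.ofReal_toReal hJ]
  rw [← ENNReal.ofReal_mul hc, expNeg_ofReal (mul_nonneg hc ENNReal.toReal_nonneg),
    ENNReal.toReal_ofReal (Real.exp_pos _).le, neg_mul]

end JointTransmission

/-! ### Assembly of the theorem. -/

open JointTransmission in
theorem lemma1 {Ω : Type*} [MeasurableSpace Ω] (P : Measure Ω) [IsProbabilityMeasure P]
    (K : ℕ) (rb θb : Fin K → ℝ) (hrb : ∀ k, 0 ≤ rb k)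
    (α ρ lam : ℝ) (hα : 0 < α) (hρ : 0 < ρ) (hlam : 0 < lam)
    (e : ℕ → Ω → Plane) (h : ℕ → Fin K → Ω → ℂ)
    (hmodel : IsRayleighPoissonModel P K lam e h)
    (s : ℝ) (hs : 0 ≤ s) :
    -- the Laplace transform, as an identity in `[0, ∞]`, for every exponent
    Measurable (aggregateSNR rb θb α ρ e h) ∧
    laplaceTransform P (aggregateSNR rb θb α ρ e h) s =
      expNeg (ENNReal.ofReal lam * ∫⁻ r in Ioi (0 : ℝ), ∫⁻ θ in Ioo (0 : ℝ) (2 * Real.pi),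
        ENNReal.ofReal (integrand rb θb α ρ s r θ * r)) ∧
    -- for exponents above two everything is finite, and it is an identity of real numbers
    (2 < α →
      (∀ᵐ ω ∂P, Summable fun j => snr rb θb α ρ e h j ω) ∧
      Integrable (fun ω => Real.exp (-s * ∑' j, snr rb θb α ρ e h j ω)) P ∧
      IntegrableOn (fun p : ℝ × ℝ => integrand rb θb α ρ s p.1 p.2 * p.1)
        (Ioi (0 : ℝ) ×ˢ Ioo (0 : ℝ) (2 * Real.pi)) ∧
      ∫ ω, Real.exp (-s * ∑' j, snr rb θb α ρ e h j ω) ∂P =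
        Real.exp (-lam * ∫ r in Ioi (0 : ℝ), ∫ θ in (0 : ℝ)..(2 * Real.pi),
          integrand rb θb α ρ s r θ * r)) ∧
    -- if the base stations are symmetric about the polar axis, half of the angles suffice
    (IsAxiallySymmetric rb θb →
      laplaceTransform P (aggregateSNR rb θb α ρ e h) s =
        expNeg (2 * ENNReal.ofReal lam * ∫⁻ r in Ioi (0 : ℝ), ∫⁻ θ in Ioo (0 : ℝ) Real.pi,
          ENNReal.ofReal (integrand rb θb α ρ s r θ * r)) ∧
      (2 < α →
        ∫ ω, Real.exp (-s * ∑' j, snr rb θb α ρ e h j ω) ∂P =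
          Real.exp (-2 * lam * ∫ r in Ioi (0 : ℝ), ∫ θ in (0 : ℝ)..Real.pi,
            integrand rb θb α ρ s r θ * r))) := by
  set I : ℝ → ℝ≥0∞ := fun a => ∫⁻ r in Ioi (0 : ℝ), ∫⁻ θ in Ioo (0 : ℝ) a,
    ENNReal.ofReal (integrand rb θb α ρ s r θ * r) with hI
  have hL : laplaceTransform P (aggregateSNR rb θb α ρ e h) s =
      expNeg (ENNReal.ofReal lam * I (2 * Real.pi)) := by
    rw [hmodel.laplaceTransform_eq hρ hlam hs, lintegral_plane_eq_lintegral_integrand]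
  have hfin : 2 < α → I (2 * Real.pi) ≠ ∞ := fun hα2 => by
    simp only [hI]
    rw [← lintegral_plane_eq_lintegral_integrand]
    exact (lintegral_meanSNR_div_lt_top _ hα2 (mul_nonneg hs hρ.le)).ne
  have hm : Measurable fun p : ℝ × ℝ => integrand rb θb α ρ s p.1 p.2 * p.1 :=
    (measurable_integrand rb θb α ρ s).mul measurable_fst
  have h0 : ∀ r, 0 < r → ∀ θ, 0 ≤ integrand rb θb α ρ s r θ * r := fun r hr θ =>
    mul_nonneg (integrand_nonneg rb θb α r θ hρ hs) hr.le
  refine ⟨hmodel.measurable_aggregateSNR, hL, fun hα2 => ?_, fun hsym => ?_⟩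
  · obtain ⟨hint, heq⟩ := integrableOn_and_integral_strip
      (f := fun r θ => integrand rb θb α ρ s r θ * r) Real.two_pi_pos.le hm h0 (hfin hα2)
    obtain ⟨hexp, hval⟩ := hmodel.integrable_exp_and_integral
      (rb := rb) (θb := θb) hρ hlam hα2 hs
    refine ⟨?_, hexp, hint, ?_⟩
    · filter_upwards [hmodel.ae_aggregateSNR_ne_top hρ hlam hα2] with ω hω
      exact summable_snr hρ hω
    · rw [hval, hL, heq, toReal_expNeg_ofReal_mul hlam.le (hfin hα2)]
  · have hhalf : I (2 * Real.pi) = 2 * I Real.pi := by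
      simp only [hI, hsym.lintegral_integrand]
      exact lintegral_const_mul' _ _ (by simp)
    have hL' : laplaceTransform P (aggregateSNR rb θb α ρ e h) s =
        expNeg (2 * ENNReal.ofReal lam * I Real.pi) := by
      rw [hL, hhalf]
      congr 1
      ring
    refine ⟨hL', fun hα2 => ?_⟩
    have hfin' : I Real.pi ≠ ∞ := fun h' => hfin hα2 (by simp [hhalf, h'])
    obtain ⟨-, heq⟩ := integrableOn_and_integral_strip
      (f := fun r θ => integrand rb θb α ρ s r θ * r) Real.pi_pos.le hm h0 hfin'
    obtain ⟨-, hval⟩ := hmodel.integrable_exp_and_integral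
      (rb := rb) (θb := θb) hρ hlam hα2 hs
    have h2 : 2 * ENNReal.ofReal lam = ENNReal.ofReal (2 * lam) := by
      rw [ENNReal.ofReal_mul (by norm_num)]
      simp
    rw [hval, hL', heq, h2, toReal_expNeg_ofReal_mul (by linarith) hfin', neg_mul 2 lam]
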